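/- Let $q(x_1,\dots,x_k)\,{:\!-}\,S_1(\mathbf y_1),\dots,S_l(\mathbf y_l)$ be a full conjunctive query without self-joins: each $\mathbf y_j$ is a vector of $r_j\ge 1$ distinct variables, and every variable occurs in some atom. A database $I$ over the domain $[n]$ consists of one relation $S_j\subseteq[n]^{r_j}$ per atom, and $q(I)\subseteq[n]^k$ is the natural join of these relations. A fractional edge packing of $q$ is a vector $\mathbf u=(u_1,\dots,u_l)$ with $u_j\ge 0$ and $\sum_{j:\,x_i\in S_j}u_j\le 1$ for every variable $x_i$; put $u=\sum_j u_j$ and assume $u>0$. One-round algorithms on $p$ machines work as follows. Each relation is stored at a location of its own. The location of $S_j$ sends to each machine $c$ a bit string that is an arbitrary function of $S_j$ (and of $c$, $j$); machine $c$ then outputs a set of tuples that is an arbitrary function of the bit strings it received, and the output of the algorithm is the union over all machines. The algorithm may be randomized, with random coins shared by all locations and machines. It must output only answers: for every database in the support of the input distribution (and almost all coins) the output is contained in $q(I)$. If machine $c$ receives $N_c$ bits in total, its cost is $g_c(N_c)=N_c/w_c$, with $w_c>0$. The load of the algorithm (for given coins) is the maximum of $N_c/w_c$ over all machines $c$ and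 all databases in the support of the input distribution. Write $\|\mathbf w\|_u=\bigl(\sum_{c\in[p]}w_c^u\bigr)^{1/u}$. For every $\theta\in(0,1)$ there is a constant $C>0$, depending only on $\theta$, such that the following holds for all $q$, $\mathbf u$, $n$, $m$, $p$, $\mathbf w$ as above. 1. (Matching databases.) Let $n\ge 2$ and $m\le n$, and let $m\le\theta n$ if some atom has arity $1$. Let $\mathcal I$ be the uniform distribution on the databases over $[n]$ in which every relation has exactly $m$ tuples and, for every attribute, contains each value at most once in that attribute. Then every one-round algorithm whose expected number of output tuples, over $I\sim\mathcal I$ and the coins, is at least $E_{I\sim\mathcal I}[|q(I)|]$ has, for almost all coins, load at least $C\,m/\|\mathbf w\|_u$. 2. ($\theta$-dense databases.) Let $m=\lfloor\theta n^{r_j}\rfloor$ for every $j$, and let $\mathcal I^d$ be the uniform distribution on the databases over $[n]$ in which every relation $S_j$ is a set of exactly $m$ of the $n^{r_j}$ possible tuples. Then every one-round algorithm whose expected number of output tuples, over $I\sim\mathcal I^d$ and the coins, is at least $E_{I\sim\mathcal I^d}[|q(I)|]$ has, for almost all coins, load at least $C\,m/\|\mathbf w\|_u$. -/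

import Mathlib

open Finset MeasureTheory
open scoped BigOperators NNReal

/-- A full conjunctive query without self-joins, with `k` variables and `l` atoms. Atom `j` is
`S_j(y_j)`, where `y_j = atom j` is a vector of `arity j ≥ 1` distinct variables (a repeated
variable would be a selection), and every variable occurs in some atom. -/
structure ConjunctiveQuery (k l : ℕ) where
  arity : Fin l → ℕ
  arity_pos : ∀ j, 0 < arity j
  atom : ∀ j, Fin (arity j) ↪ Fin k
  covers : ∀ i, ∃ j s, atom j s = i

/-- A relation of arity `r` over a domain with `n` elements. -/
abbrev Relation (r n : ℕ) : Type := Finset (Fin r → Fin n)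

/-- In a matching relation, every value occurs at most once in every attribute. -/
def Relation.IsMatching {r n : ℕ} (R : Relation r n) : Prop :=
  ∀ s : Fin r, ∀ a ∈ R, ∀ b ∈ R, a s = b s → a = b

namespace ConjunctiveQuery

variable {k l : ℕ} (q : ConjunctiveQuery k l)

/-- A database instance: one relation for every atom. -/
abbrev Database (n : ℕ) : Type := ∀ j : Fin l, Relation (q.arity j) n

/-- The answer `q(I)`: the natural join of the relations of `I`. -/
def eval {n : ℕ} (I : q.Database n) : Finset (Fin k → Fin n) :=
  {a | ∀ j, (fun s => a (q.atom j s)) ∈ I j}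

open Classical in
/-- A fractional edge packing: nonnegative weights on the atoms such that, for every variable, the
weights of the atoms that contain it sum to at most one. -/
def IsFractionalEdgePacking (u : Fin l → ℝ) : Prop :=
  (∀ j, 0 ≤ u j) ∧ ∀ i : Fin k, ∑ j with i ∈ Set.range (q.atom j), u j ≤ 1

open Classical in
/-- The matching databases over a domain of size `n` with `m` tuples in every relation. -/
noncomputable def matchingDatabases (n m : ℕ) : Finset (q.Database n) :=
  {I | ∀ j, (I j).IsMatching ∧ (I j).card = m}

open Classical in
/-- The `θ`-dense databases over a domain of size `n`: each relation has a fraction `θ` of all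
possible tuples (rounded down if that is not a whole number). -/
noncomputable def denseDatabases (θ : ℝ) (n : ℕ) : Finset (q.Database n) :=
  {I | ∀ j, (I j).card = ⌊θ * (n : ℝ) ^ q.arity j⌋₊}

/-- A (deterministic) one-round algorithm on `p` machines. Each relation is stored at a location of
its own; the location of `S_j` sends to machine `c` an arbitrary bit string `msg c j S_j`, and then
machine `c` outputs an arbitrary set of tuples that depends only on the bit strings it received. -/
structure OneRoundAlgorithm (n p : ℕ) where
  msg : Fin p → ∀ j : Fin l, Relation (q.arity j) n → List Bool
  out : Fin p → (Fin l → List Bool) → Finset (Fin k → Fin n)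

namespace OneRoundAlgorithm

variable {q} {n p : ℕ} (A : q.OneRoundAlgorithm n p)

/-- The number of bits that machine `c` receives on input `I`. -/
def bits (I : q.Database n) (c : Fin p) : ℕ := ∑ j, (A.msg c j (I j)).length

/-- The output on input `I`: the union of the outputs of all machines. -/
def output (I : q.Database n) : Finset (Fin k → Fin n) :=
  univ.biUnion fun c => A.out c fun j => A.msg c j (I j)

/-- On the inputs in `D`, the algorithm outputs only answers of the query. -/
def IsSoundOn (D : Finset (q.Database n)) : Prop := ∀ I ∈ D, A.output I ⊆ q.eval I

/-- The load on the inputs in `D` for the cost functions `g`: the largest cost of a machine on an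
input in `D`. -/
noncomputable def load (D : Finset (q.Database n)) (g : Fin p → ℕ → ℝ≥0) : ℝ≥0 :=
  D.sup fun I => univ.sup fun c => g c (A.bits I c)

end OneRoundAlgorithm

end ConjunctiveQuery

/-- The linear cost functions `g_c(N) = N / w_c`. -/
noncomputable def linearCost {p : ℕ} (w : Fin p → ℝ≥0) (c : Fin p) (N : ℕ) : ℝ≥0 := N / w c

/-- `m / ‖w‖_t`, where `‖w‖_t = (∑ c, w_c ^ t) ^ (1 / t)`. -/
noncomputable def lowerLoad {p : ℕ} (m : ℕ) (w : Fin p → ℝ≥0) (t : ℝ) : ℝ≥0 :=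
  m / (∑ c, w c ^ t) ^ (1 / t)

/-! Soundness together with full expected output forces the algorithm to be exact for almost all
coins (`ae_output_eq_eval`), so it suffices to bound the load of an exact deterministic algorithm.

Both input distributions are uniform on a product of families `F j`, so the relations are
independent. If machine `c` outputs `a`, the projection of `a` to atom `j` must lie in every
relation of `F j` that has the same message; call such tuples known. Hence for each `a` the
probability `∏ j, m / n ^ r_j` that `a` is an answer is at most the sum over `c` of the products of
the probabilities that `c` knows the projections of `a`. After division by the left side, the
factors lie in `[0, 1]`, so raising them to the powers `u j ≤ 1` only enlarges them. Averaging over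
`a` with Finner's inequality gives `1 ≤ ∑ c, ∏ j, (E_cj / m) ^ u j`, where `E_cj` is the mean number
of tuples of `S_j` known to `c` (`one_le_sum_prod_expect_card_known`).

Each family is `β`-spread: fixing `t` tuples costs a factor `β ^ t` in probability. A bit string of
length at most `N` therefore reveals at most `N * log 4 / log β⁻¹` tuples on average
(`IsSpreadFamily.expect_card_revealed_le`). With load `L`, `N ≤ L * w c`, so `1 ≤ (K * L / m) ^ t *
∑ c, w c ^ t` for `t = ∑ j, u j` and `K = log 4 / log β⁻¹`; the `t`-th root is the claim. -/

/-! ### Hölder's and Finner's inequalities for uniform averages -/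

/-- Hölder's inequality for several functions on a finite uniform probability space. -/
lemma expect_prod_rpow_le_of_sum_le_one {α ι : Type*} [Fintype α] [Nonempty α] (s : Finset ι)
    (f : ι → α → ℝ) (u : ι → ℝ) (hf : ∀ j ∈ s, ∀ x, 0 ≤ f j x) (hu : ∀ j ∈ s, 0 ≤ u j)
    (hs : ∑ j ∈ s, u j ≤ 1) :
    𝔼 x, ∏ j ∈ s, f j x ^ u j ≤ ∏ j ∈ s, (𝔼 x, f j x) ^ u j := by
  have hM : ∀ j ∈ s, 0 ≤ 𝔼 x, f j x := fun j hj => expect_nonneg fun x _ => hf j hj x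
  -- The argument normalises by the means. A function of mean zero and nonzero weight vanishes
  -- identically and makes the left side zero; with weight zero it contributes the factor one.
  by_cases h0 : ∃ j ∈ s, 𝔼 x, f j x = 0 ∧ u j ≠ 0
  · obtain ⟨j, hj, hfj, huj⟩ := h0
    have hz : ∀ x, f j x = 0 := by
      have := (expect_eq_zero_iff_of_nonneg (s := univ)
        (fun x _ => hf j hj x)).1 hfj
      exact fun x => this x (mem_univ x)
    refine le_trans (le_of_eq ?_) (prod_nonneg fun j hj => Real.rpow_nonneg (hM j hj) _)
    refine expect_eq_zero fun x _ => prod_eq_zero hj ?_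
    rw [hz x, Real.zero_rpow huj]
  · push Not at h0
    have key : ∀ x, ∏ j ∈ s, f j x ^ u j ≤ (∏ j ∈ s, (𝔼 y, f j y) ^ u j) *
        ((1 - ∑ j ∈ s, u j) + ∑ j ∈ s, u j * (f j x / 𝔼 y, f j y)) := by
      intro x
      have h1 : ∏ j ∈ s, f j x ^ u j =
          (∏ j ∈ s, (𝔼 y, f j y) ^ u j) * ∏ j ∈ s, (f j x / 𝔼 y, f j y) ^ u j := by
        rw [← prod_mul_distrib]
        refine prod_congr rfl fun j hj => ?_
        by_cases hj0 : 𝔼 y, f j y = 0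
        · simp [h0 j hj hj0]
        · rw [← Real.mul_rpow (hM j hj) (div_nonneg (hf j hj x) (hM j hj)), mul_div_cancel₀ _ hj0]
      rw [h1]
      refine mul_le_mul_of_nonneg_left ?_
        (prod_nonneg fun j hj => Real.rpow_nonneg (hM j hj) _)
      -- Weighted AM-GM needs total weight one: the extra index `none` carries the missing weight on
      -- the constant function `1`.
      have h2 := Real.geom_mean_le_arith_mean_weighted (insertNone s)
        (fun o => o.elim (1 - ∑ j ∈ s, u j) u)
        (fun o => o.elim 1 fun j => f j x / 𝔼 y, f j y)
        (by
          rintro (_ | j) hj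
          · simpa using hs
          · exact hu j (by simpa using hj))
        (by simp [sum_insertNone])
        (by
          rintro (_ | j) hj
          · simp
          · have hj' : j ∈ s := by simpa using hj
            exact div_nonneg (hf j hj' x) (hM j hj'))
      simpa [sum_insertNone, prod_insertNone] using h2
    refine (expect_le_expect fun x _ => key x).trans ?_
    rw [← mul_expect, expect_add_distrib, expect_const univ_nonempty, expect_sum_comm]
    refine mul_le_of_le_one_right (prod_nonneg fun j hj => Real.rpow_nonneg (hM j hj) _) ?_
    have h3 : ∑ j ∈ s, 𝔼 x, u j * (f j x / 𝔼 y, f j y) ≤ ∑ j ∈ s, u j := by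
      refine sum_le_sum fun j hj => ?_
      rw [← mul_expect, ← expect_div]
      exact mul_le_of_le_one_right (hu j hj) (div_self_le_one _)
    linarith

lemma expect_fin_succ {X : Type*} [Fintype X] {k : ℕ} (g : (Fin (k + 1) → X) → ℝ) :
    𝔼 a, g a = 𝔼 x, 𝔼 b : Fin k → X, g (Fin.cons x b) := by
  rw [← expect_product' univ univ fun x (b : Fin k → X) => g (Fin.cons x b), univ_product_univ]
  exact (Fintype.expect_equiv (Fin.consEquiv fun _ => X) _ _ fun _ => rfl).symm

open Classical in
/-- Finner's inequality for the uniform measure on `X ^ k`. -/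
theorem expect_prod_rpow_le_of_dependsOn {X ι : Type*} [Fintype X] [Nonempty X] [Fintype ι] :
    ∀ (k : ℕ) (f : ι → (Fin k → X) → ℝ) (A : ι → Set (Fin k)) (u : ι → ℝ),
      (∀ j, DependsOn (f j) (A j)) → (∀ j a, 0 ≤ f j a) → (∀ j, 0 ≤ u j) →
      (∀ i, ∑ j with i ∈ A j, u j ≤ 1) →
      𝔼 a, ∏ j, f j a ^ u j ≤ ∏ j, (𝔼 a, f j a) ^ u j
  | 0, f, A, u, _, _, _, _ => by
    simp
  | k + 1, f, A, u, hd, hf, hu, hA => by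
    set g : ι → X → ℝ := fun j x => 𝔼 b : Fin k → X, f j (Fin.cons x b) with hg
    have hg0 : ∀ j x, 0 ≤ g j x := fun j x => expect_nonneg fun b _ => hf _ _
    have hconst : ∀ j, (0 : Fin (k + 1)) ∉ A j → ∀ x y, g j x = g j y := by
      intro j hj x y
      refine expect_congr rfl fun b _ => hd j ?_
      intro i hi
      induction i using Fin.cases with
      | zero => exact absurd hi hj
      | succ i => simp
    -- Only the functions that depend on coordinate `0` enter Hölder, and their weights sum to at
    -- most one by the packing condition at `0`; the others are constant and factor out.
    have hstep : 𝔼 x, ∏ j, g j x ^ u j ≤ ∏ j, (𝔼 x, g j x) ^ u j := by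
      obtain ⟨x₀⟩ := ‹Nonempty X›
      have h1 : ∀ x, ∏ j, g j x ^ u j =
          (∏ j with (0 : Fin (k + 1)) ∈ A j, g j x ^ u j) *
            ∏ j with (0 : Fin (k + 1)) ∉ A j, g j x₀ ^ u j := by
        intro x
        rw [← prod_filter_mul_prod_filter_not univ fun j => (0 : Fin (k + 1)) ∈ A j]
        congr 1
        refine prod_congr rfl fun j hj => ?_
        rw [hconst j (mem_filter.1 hj).2 x x₀]
      have h2 : ∏ j, (𝔼 x, g j x) ^ u j =
          (∏ j with (0 : Fin (k + 1)) ∈ A j, (𝔼 x, g j x) ^ u j) *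
            ∏ j with (0 : Fin (k + 1)) ∉ A j, g j x₀ ^ u j := by
        rw [← prod_filter_mul_prod_filter_not univ fun j => (0 : Fin (k + 1)) ∈ A j]
        congr 1
        refine prod_congr rfl fun j hj => ?_
        rw [expect_congr rfl fun x _ => hconst j (mem_filter.1 hj).2 x x₀,
          expect_const ⟨x₀, mem_univ _⟩]
      simp_rw [h1]
      rw [h2, ← expect_mul]
      have : Nonempty X := ⟨x₀⟩
      exact mul_le_mul_of_nonneg_right
        (expect_prod_rpow_le_of_sum_le_one _ g u (fun j _ => hg0 j) (fun j _ => hu j) (hA 0))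
        (prod_nonneg fun j _ => Real.rpow_nonneg (hg0 j x₀) _)
    rw [expect_fin_succ]
    simp_rw [expect_fin_succ (f _)]
    refine le_trans (expect_le_expect fun x _ => ?_) hstep
    refine expect_prod_rpow_le_of_dependsOn k (fun j b => f j (Fin.cons x b))
      (fun j => {i | i.succ ∈ A j}) u ?_ (fun j b => hf _ _) hu (fun i => hA i.succ)
    intro j a b hab
    refine hd j fun i hi => ?_
    induction i using Fin.cases with
    | zero => simp
    | succ i => simpa using hab i hi

/-- The restriction of a uniform point of `X ^ α` to some of the coordinates is uniform. -/
lemma expect_comp_embedding {α β X : Type*} [Fintype α] [Fintype β] [DecidableEq α]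
    [DecidableEq β] [Fintype X] [Nonempty X] (e : β ↪ α) (g : (β → X) → ℝ) :
    𝔼 a : α → X, g (fun s => a (e s)) = 𝔼 b, g b := by
  classical
  let E : (α → X) ≃ (β → X) × ({i // i ∉ Set.range e} → X) :=
    (Equiv.piEquivPiSubtypeProd (fun i => i ∈ Set.range e) fun _ => X).trans
      (((Equiv.ofInjective e e.injective).symm.arrowCongr (Equiv.refl X)).prodCongr
        (Equiv.refl _))
  have hE : 𝔼 a : α → X, g (fun s => a (e s)) = 𝔼 z, g (z : (β → X) × _).1 :=
    Fintype.expect_equiv E _ _ fun _ => rfl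
  rw [hE, ← univ_product_univ, expect_product]
  exact expect_congr rfl fun b _ => expect_const univ_nonempty (g b)

/-! ### What a short message can reveal about a set -/

open Classical in
/-- The elements that lie in every set of the family `F` with message `v`. -/
noncomputable def revealed {α M : Type*} [Fintype α] (F : Finset (Finset α)) (f : Finset α → M)
    (v : M) : Finset α :=
  {a | ∀ S ∈ F, f S = v → a ∈ S}

lemma mem_revealed {α M : Type*} [Fintype α] {F : Finset (Finset α)} {f : Finset α → M}
    {v : M} {a : α} : a ∈ revealed F f v ↔ ∀ S ∈ F, f S = v → a ∈ S := by
  simp [revealed]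

/-- `F` is `β`-spread if a uniform member contains any given set `T` with probability at most
`β ^ #T`. -/
def IsSpreadFamily {α : Type*} [DecidableEq α] (F : Finset (Finset α)) (β : ℝ) : Prop :=
  ∀ T : Finset α, (#{S ∈ F | T ⊆ S} : ℝ) ≤ β ^ #T * #F

lemma IsSpreadFamily.mono {α : Type*} [DecidableEq α] {F : Finset (Finset α)} {β γ : ℝ}
    (h : IsSpreadFamily F β) (hβ : 0 ≤ β) (hγ : β ≤ γ) : IsSpreadFamily F γ := fun T =>
  (h T).trans (by gcongr)

/-- In a spread family, messages with few values reveal few elements on average. -/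
lemma IsSpreadFamily.expect_card_revealed_le_log {α M : Type*} [Fintype α] [DecidableEq α]
    [DecidableEq M]
    {F : Finset (Finset α)} {β : ℝ} (h : IsSpreadFamily F β) (hF : F.Nonempty) (hβ₀ : 0 < β)
    (hβ₁ : β < 1) (f : Finset α → M) :
    𝔼 S ∈ F, (#(revealed F f (f S)) : ℝ) ≤ Real.log #(F.image f) / Real.log β⁻¹ := by
  have hlog : 0 < Real.log β⁻¹ := Real.log_pos ((one_lt_inv₀ hβ₀).2 hβ₁)
  have hFc : (0 : ℝ) < #F := by exact_mod_cast hF.card_pos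
  have hexp : ∀ t : ℕ, Real.exp (t * Real.log β⁻¹) = (β ^ t)⁻¹ := by
    intro t
    rw [← Real.log_pow, Real.exp_log (by positivity), inv_pow]
  -- Jensen moves the mean into the exponent, where the spread condition can be applied to each
  -- message value.
  have hjensen : Real.exp (𝔼 S ∈ F, (#(revealed F f (f S)) * Real.log β⁻¹)) ≤
      𝔼 S ∈ F, (β ^ #(revealed F f (f S)))⁻¹ := by
    have := convexOn_exp.map_sum_le (t := F) (w := fun _ => (#F : ℝ)⁻¹)
      (p := fun S => #(revealed F f (f S)) * Real.log β⁻¹) (fun _ _ => by positivity)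
      (by simp [hFc.ne']) (fun _ _ => Set.mem_univ _)
    simp only [hexp, smul_eq_mul, ← mul_sum] at this
    rwa [expect_eq_sum_div_card, expect_eq_sum_div_card, div_eq_inv_mul, div_eq_inv_mul]
  have hcount : 𝔼 S ∈ F, (β ^ #(revealed F f (f S)))⁻¹ ≤ #(F.image f) := by
    rw [expect_eq_sum_div_card, div_le_iff₀ hFc,
      sum_comp (fun v => (β ^ #(revealed F f v))⁻¹) f, ← nsmul_eq_mul, ← sum_const]
    -- All members with message `v` contain the set revealed by `v`, so spreadness bounds their
    -- number. Each value thus contributes at most `#F`.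
    refine sum_le_sum fun v _ => ?_
    rw [nsmul_eq_mul, ← div_eq_mul_inv, div_le_iff₀ (by positivity), mul_comm]
    refine le_trans ?_ (h (revealed F f v))
    refine Nat.cast_le.2 (card_le_card fun S hS => ?_)
    rw [mem_filter] at hS ⊢
    exact ⟨hS.1, fun a ha => mem_revealed.1 ha S hS.1 hS.2⟩
  have hle := hjensen.trans hcount
  rw [← expect_mul] at hle
  rw [le_div_iff₀ hlog]
  exact (Real.le_log_iff_exp_le (by exact_mod_cast (hF.image f).card_pos)).2 hle

/-- There are at most `4 ^ N` bit strings of length at most `N`. -/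
lemma card_le_four_pow_of_length_le (s : Finset (List Bool)) (N : ℕ)
    (hs : ∀ x ∈ s, x.length ≤ N) : #s ≤ 4 ^ N := by
  classical
  have hsub : s ⊆ (range (N + 1)).biUnion fun i =>
      (univ : Finset (List.Vector Bool i)).image List.Vector.toList := by
    intro x hx
    exact mem_biUnion.2 ⟨x.length, mem_range.2 (Nat.lt_succ_of_le (hs x hx)),
      mem_image.2 ⟨⟨x, rfl⟩, mem_univ _, rfl⟩⟩
  -- The sum is `2 ^ (N + 1) - 1`. The cruder `4 ^ N` equals `1` at `N = 0`, so its logarithm is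
  -- proportional to `N` with no additive term.
  have hgeom : ∀ N : ℕ, ∑ i ∈ range (N + 1), 2 ^ i ≤ 4 ^ N := by
    intro N
    induction N with
    | zero => simp
    | succ N ih =>
      rw [sum_range_succ, pow_succ 4, pow_succ 2]
      have : 2 ^ N ≤ 4 ^ N := Nat.pow_le_pow_left (by norm_num) N
      have : 1 ≤ 2 ^ N := Nat.one_le_two_pow
      omega
  calc #s ≤ _ := card_le_card hsub
    _ ≤ _ := card_biUnion_le
    _ ≤ ∑ i ∈ range (N + 1), 2 ^ i := by
      refine sum_le_sum fun i _ => card_image_le.trans ?_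
      rw [card_univ, card_vector, Fintype.card_bool]
    _ ≤ 4 ^ N := hgeom N

/-- In a spread family, the mean number of elements that are revealed by a bit string is at most
proportional to the maximal length of the string. -/
lemma IsSpreadFamily.expect_card_revealed_le {α : Type*} [Fintype α] [DecidableEq α]
    {F : Finset (Finset α)} {β : ℝ} (h : IsSpreadFamily F β) (hF : F.Nonempty) (hβ₀ : 0 < β)
    (hβ₁ : β < 1) (f : Finset α → List Bool) (N : ℕ) (hN : ∀ S ∈ F, (f S).length ≤ N) :
    𝔼 S ∈ F, (#(revealed F f (f S)) : ℝ) ≤ Real.log 4 / Real.log β⁻¹ * N := by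
  have hlog : 0 < Real.log β⁻¹ := Real.log_pos ((one_lt_inv₀ hβ₀).2 hβ₁)
  refine (h.expect_card_revealed_le_log hF hβ₀ hβ₁ f).trans ?_
  rw [div_mul_eq_mul_div]
  refine div_le_div_of_nonneg_right ?_ hlog.le
  rw [mul_comm, ← Real.log_pow]
  refine Real.log_le_log (by exact_mod_cast (hF.image f).card_pos) ?_
  exact_mod_cast card_le_four_pow_of_length_le (F.image f) N (by simpa using hN)

/-! ### Dense families are spread -/

/-- The ratio of the binomials is the product of `(M - i) / (N - i)` over `i < t`, and each factor
is at most `θ` because `M ≤ θ * N` and `θ ≤ 1`. -/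
lemma choose_sub_sub_le {θ : ℝ} (hθ₀ : 0 ≤ θ) (hθ₁ : θ ≤ 1) {N M : ℕ} (hMN : (M : ℝ) ≤ θ * N)
    (hle : M ≤ N) :
    ∀ t ≤ M, ((N - t).choose (M - t) : ℝ) ≤ θ ^ t * N.choose M := by
  intro t
  induction t with
  | zero => simp
  | succ t ih =>
    intro ht
    obtain ⟨b, rfl⟩ : ∃ b, M = b + (t + 1) := ⟨M - (t + 1), by omega⟩
    obtain ⟨a, rfl⟩ : ∃ a, N = a + (t + 1) := ⟨N - (t + 1), by omega⟩
    have ih := ih (by omega)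
    rw [show a + (t + 1) - t = a + 1 by omega, show b + (t + 1) - t = b + 1 by omega] at ih
    rw [Nat.add_sub_cancel, Nat.add_sub_cancel]
    have hid : ((a : ℝ) + 1) * a.choose b = (a + 1).choose (b + 1) * (b + 1) := by
      exact_mod_cast Nat.add_one_mul_choose_eq a b
    have hb : (b : ℝ) + 1 ≤ θ * (a + 1) := by
      push_cast at hMN
      nlinarith [mul_nonneg (sub_nonneg.2 hθ₁) (Nat.cast_nonneg (α := ℝ) t)]
    have hpos : (0 : ℝ) < a + 1 := by positivity
    refine le_of_mul_le_mul_left ?_ hpos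
    rw [hid]
    calc ((a + 1).choose (b + 1) : ℝ) * (b + 1)
        ≤ (θ ^ t * (a + (t + 1)).choose (b + (t + 1))) * (θ * (a + 1)) := by gcongr
      _ = _ := by ring

lemma isSpreadFamily_powersetCard {α : Type*} [Fintype α] [DecidableEq α] {θ : ℝ}
    (hθ₀ : 0 ≤ θ) (hθ₁ : θ ≤ 1)
    {m : ℕ} (hm : (m : ℝ) ≤ θ * Fintype.card α) :
    IsSpreadFamily (powersetCard m (univ : Finset α)) θ := by
  intro T
  have hmα : m ≤ Fintype.card α := by
    have : (m : ℝ) ≤ Fintype.card α :=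
      hm.trans (mul_le_of_le_one_left (Nat.cast_nonneg _) hθ₁)
    exact_mod_cast this
  by_cases hT : #T ≤ m
  · rw [card_powersetCard, card_univ]
    convert choose_sub_sub_le hθ₀ hθ₁ hm hmα (#T) hT using 2
    rw [← card_univ, ← card_filter_powersetCard_subset T univ m (subset_univ T) hT]
  · rw [filter_eq_empty_iff.2]
    · simpa using by positivity
    · intro S hS hTS
      exact hT ((card_le_card hTS).trans (mem_powersetCard.1 hS).2.le)

/-! ### Families of relations that are invariant under coordinatewise permutations -/

/-- Apply permutations of the domain to the attributes of a relation. -/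
def Relation.permute {r n : ℕ} (σ : Fin r → Equiv.Perm (Fin n)) (R : Relation r n) :
    Relation r n :=
  R.map (Equiv.piCongrRight σ).toEmbedding

namespace Relation

variable {r n : ℕ}

lemma mem_permute_of_mem (σ : Fin r → Equiv.Perm (Fin n)) {R : Relation r n} {a : Fin r → Fin n}
    (ha : a ∈ R) : (fun s => σ s (a s)) ∈ R.permute σ :=
  mem_map_of_mem _ ha

lemma permute_injective (σ : Fin r → Equiv.Perm (Fin n)) :
    Function.Injective (permute σ) :=
  map_injective _

@[simp] lemma card_permute (σ : Fin r → Equiv.Perm (Fin n)) (R : Relation r n) :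
    #(R.permute σ) = #R :=
  card_map _

lemma IsMatching.permute {R : Relation r n} (hR : R.IsMatching)
    (σ : Fin r → Equiv.Perm (Fin n)) : (R.permute σ).IsMatching := by
  intro s a ha b hb hab
  obtain ⟨a, ha', rfl⟩ := mem_map.1 ha
  obtain ⟨b, hb', rfl⟩ := mem_map.1 hb
  rw [hR s a ha' b hb' ((σ s).injective hab)]

/-- A family of relations is symmetric if it is closed under permutations of the domain in every
attribute. -/
def IsSymmetricFamily (F : Finset (Relation r n)) : Prop :=
  ∀ σ : Fin r → Equiv.Perm (Fin n), ∀ R ∈ F, R.permute σ ∈ F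

/-- In a symmetric family, all tuples are equally likely. -/
lemma IsSymmetricFamily.card_filter_mem {F : Finset (Relation r n)} (hF : IsSymmetricFamily F)
    {m : ℕ} (hm : ∀ R ∈ F, #R = m) (a : Fin r → Fin n) :
    n ^ r * #{R ∈ F | a ∈ R} = m * #F := by
  have hle : ∀ a b : Fin r → Fin n, #{R ∈ F | a ∈ R} ≤ #{R ∈ F | b ∈ R} := by
    intro a b
    -- Swapping `a s` with `b s` in every attribute carries relations containing `a` injectively to
    -- relations containing `b`.
    refine card_le_card_of_injOn (permute fun s => Equiv.swap (a s) (b s)) ?_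
      (permute_injective _).injOn
    intro R hR
    obtain ⟨hRF, haR⟩ := mem_filter.1 hR
    refine mem_coe.2 (mem_filter.2 ⟨hF _ R hRF, ?_⟩)
    simpa using mem_permute_of_mem (fun s => Equiv.swap (a s) (b s)) haR
  have := sum_card (B := F) fun b => le_antisymm (hle b a) (hle a b)
  rw [sum_congr rfl hm, sum_const, smul_eq_mul, mul_comm] at this
  simpa using this.symm

open Classical in
/-- The matching relations with `m` tuples. -/
noncomputable def matchings (r n m : ℕ) : Finset (Relation r n) := {R | R.IsMatching ∧ #R = m}

lemma mem_matchings {m : ℕ} {R : Relation r n} :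
    R ∈ matchings r n m ↔ R.IsMatching ∧ #R = m := by
  simp [matchings]

lemma isSymmetricFamily_matchings (m : ℕ) : IsSymmetricFamily (matchings r n m) := by
  intro σ R hR
  rw [mem_matchings] at hR ⊢
  exact ⟨hR.1.permute σ, by simpa using hR.2⟩

lemma isSymmetricFamily_powersetCard (m : ℕ) :
    IsSymmetricFamily (powersetCard m (univ : Finset (Fin r → Fin n))) := by
  intro σ R hR
  rw [mem_powersetCard] at hR ⊢
  exact ⟨subset_univ _, by simpa using hR.2⟩

lemma matchings_nonempty {m : ℕ} (hr : 0 < r) (hm : m ≤ n) : (matchings r n m).Nonempty := by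
  have hinj : Function.Injective fun (i : Fin m) (_ : Fin r) => Fin.castLE hm i := by
    intro i j hij
    simpa using congrFun hij ⟨0, hr⟩
  refine ⟨univ.map ⟨_, hinj⟩, mem_matchings.2 ⟨?_, by simp⟩⟩
  intro s a ha b hb hab
  obtain ⟨i, -, rfl⟩ := mem_map.1 ha
  obtain ⟨j, -, rfl⟩ := mem_map.1 hb
  have : i = j := by simpa using hab
  rw [this]

/-- In arity one the matching condition is vacuous. Such a relation is an arbitrary `m`-set, which
is spread only if `m` stays away from `n`; this is the role of `m ≤ θ * n`. -/
lemma matchings_one (n m : ℕ) : matchings 1 n m = powersetCard m univ := by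
  ext R
  simp only [mem_matchings, mem_powersetCard, subset_univ, true_and, and_iff_right_iff_imp]
  intro _ s a _ b _ hab
  ext t
  rw [Subsingleton.elim t s, hab]

/-- A random matching of arity at least two contains a given set of `t` tuples with probability at
most `1 / (n (n - 1) ⋯ (n - t + 1))`: the values in one attribute can be moved freely. -/
lemma descFactorial_mul_card_filter_subset_le {m : ℕ} (hr : 2 ≤ r) (T : Relation r n) :
    n.descFactorial #T * #{R ∈ matchings r n m | T ⊆ R} ≤ #(matchings r n m) := by
  rcases ({R ∈ matchings r n m | T ⊆ R}).eq_empty_or_nonempty with h | ⟨R₀, hR₀⟩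
  · simp [h]
  let s₀ : Fin r := ⟨0, by omega⟩
  let s₁ : Fin r := ⟨1, by omega⟩
  have hs : s₁ ≠ s₀ := by simp [s₀, s₁]
  have hT : Function.Injective fun a : T => (a : Fin r → Fin n) s₀ := by
    rw [mem_filter, mem_matchings] at hR₀
    intro a b hab
    exact Subtype.ext (hR₀.1.1 s₀ a (hR₀.2 a.2) b (hR₀.2 b.2) hab)
  -- `T` lies in a matching, so its values in attribute `s₀` are distinct and any injection of `T`
  -- into the domain extends to a permutation of these values. Attribute `s₁` stays fixed.
  choose π hπ using fun e : T ↪ Fin n => Equiv.Perm.exists_extending_pair _ e hT e.injective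
  let σ : (T ↪ Fin n) → Fin r → Equiv.Perm (Fin n) := fun e => Function.update 1 s₀ (π e)
  have hcard : #(univ : Finset (T ↪ Fin n)) = n.descFactorial #T := by
    rw [card_univ, Fintype.card_embedding_eq]
    simp
  rw [← hcard, ← card_product]
  refine card_le_card_of_injOn (fun z => z.2.permute (σ z.1)) ?_ ?_
  · intro z hz
    exact isSymmetricFamily_matchings m _ _ (mem_filter.1 (mem_product.1 hz).2).1
  · rintro ⟨e, R⟩ hR ⟨e', R'⟩ hR' heq
    obtain ⟨hR, hTR⟩ := mem_filter.1 (mem_product.1 hR).2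
    obtain ⟨hR', hTR'⟩ := mem_filter.1 (mem_product.1 hR').2
    -- The common image contains the images of `a` under both maps. They agree in `s₁`, so the
    -- matching property identifies them, and attribute `s₀` returns `e a = e' a`.
    have hee : e = e' := by
      ext a : 1
      have h1 := mem_permute_of_mem (σ e) (hTR a.2)
      have h2 := mem_permute_of_mem (σ e') (hTR' a.2)
      rw [← show R.permute (σ e) = R'.permute (σ e') from heq] at h2
      have h3 := ((mem_matchings.1 hR).1.permute (σ e)) s₁ _ h1 _ h2 (by simp [σ, hs])
      simpa [σ, hπ] using congrFun h3 s₀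
    subst hee
    exact Prod.ext rfl (permute_injective _ heq)

lemma two_pow_le_descFactorial {n t : ℕ} (h : t < n) : 2 ^ t ≤ n.descFactorial t := by
  induction t with
  | zero => simp
  | succ t ih =>
    rw [pow_succ, Nat.descFactorial_succ, mul_comm]
    exact Nat.mul_le_mul (by omega) (ih (by omega))

/-- For `t < n` all factors are at least `2`. For `t = n` the last factor is `1`, and `2 ^ (n - 1)`
must absorb the loss: the tightest case `n = 2` reads `16 / 9 ≤ 2`, which `4 / 3` satisfies. -/
lemma pow_le_descFactorial {n t : ℕ} (hn : 2 ≤ n) (h : t ≤ n) :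
    (4 / 3 : ℝ) ^ t ≤ n.descFactorial t := by
  rcases h.lt_or_eq with h | rfl
  · calc (4 / 3 : ℝ) ^ t ≤ 2 ^ t := by gcongr; norm_num
      _ ≤ _ := by exact_mod_cast two_pow_le_descFactorial h
  · obtain ⟨s, rfl⟩ : ∃ s, t = s + 2 := ⟨t - 2, by omega⟩
    have h1 : (2 : ℝ) ^ (s + 1) ≤ (s + 2).descFactorial (s + 1) := by
      exact_mod_cast two_pow_le_descFactorial (by omega)
    rw [Nat.descFactorial_succ, show s + 2 - (s + 1) = 1 by omega, one_mul]
    refine le_trans ?_ h1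
    calc (4 / 3 : ℝ) ^ (s + 2) = 16 / 9 * (4 / 3) ^ s := by ring
      _ ≤ 2 * 2 ^ s := by gcongr <;> norm_num
      _ = 2 ^ (s + 1) := by ring

lemma le_pow_mul_of_mul_le {t : ℕ} {x y d : ℝ} (hx : 0 ≤ x) (hd : (4 / 3 : ℝ) ^ t ≤ d)
    (h : d * x ≤ y) : x ≤ (3 / 4) ^ t * y := by
  calc x = (3 / 4) ^ t * ((4 / 3) ^ t * x) := by rw [← mul_assoc, ← mul_pow]; norm_num
    _ ≤ (3 / 4) ^ t * (d * x) := by gcongr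
    _ ≤ (3 / 4) ^ t * y := by gcongr

lemma isSpreadFamily_matchings {m : ℕ} (hr : 2 ≤ r) (hn : 2 ≤ n) :
    IsSpreadFamily (matchings r n m) (3 / 4) := by
  intro T
  by_cases hT : #T ≤ n
  · refine le_pow_mul_of_mul_le (Nat.cast_nonneg _) (pow_le_descFactorial hn hT) ?_
    have h := descFactorial_mul_card_filter_subset_le (m := m) hr T
    have h' := (Nat.cast_le (α := ℝ)).2 h
    rw [Nat.cast_mul] at h'
    exact h'
  · rw [filter_eq_empty_iff.2]
    · rw [card_empty, Nat.cast_zero]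
      positivity
    · intro R hR hTR
      refine hT ?_
      have := card_le_card_of_injOn (s := T) (t := univ) (fun a => a ⟨0, by omega⟩)
        (fun _ _ => mem_univ _)
        (fun a ha b hb hab => (mem_matchings.1 hR).1 _ a (hTR ha) b (hTR hb) hab)
      simpa using this

end Relation

/-! ### Exact deterministic algorithms on product distributions -/

lemma expect_piFinset_prod {ι : Type*} [Fintype ι] [DecidableEq ι] {κ : ι → Type*}
    (F : ∀ j, Finset (κ j)) (h : ∀ j, κ j → ℝ) :
    𝔼 I ∈ Fintype.piFinset F, ∏ j, h j (I j) = ∏ j, 𝔼 S ∈ F j, h j S := by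
  simp_rw [expect_eq_sum_div_card, prod_div_distrib, prod_univ_sum, Fintype.card_piFinset,
    Nat.cast_prod]

namespace ConjunctiveQuery

variable {k l : ℕ} {q : ConjunctiveQuery k l} {n p : ℕ}

lemma mem_eval {I : q.Database n} {a : Fin k → Fin n} :
    a ∈ q.eval I ↔ ∀ j, (fun s => a (q.atom j s)) ∈ I j := by
  simp [eval]

lemma IsFractionalEdgePacking.le_one {u : Fin l → ℝ} (hu : q.IsFractionalEdgePacking u)
    (j : Fin l) : u j ≤ 1 := by
  refine le_trans ?_ (hu.2 (q.atom j ⟨0, q.arity_pos j⟩))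
  refine single_le_sum (f := u) (fun i _ => hu.1 i) (mem_filter.2 ⟨mem_univ j, ?_⟩)
  exact ⟨_, rfl⟩

namespace OneRoundAlgorithm

variable (A : q.OneRoundAlgorithm n p) (F : ∀ j, Finset (Relation (q.arity j) n))

/-- The tuples of `S_j` that machine `c` knows after it has received the message about `S`. -/
noncomputable def known (c : Fin p) (j : Fin l) (S : Relation (q.arity j) n) :
    Finset (Fin (q.arity j) → Fin n) :=
  revealed (F j) (A.msg c j) (A.msg c j S)

variable {A F}

lemma known_subset {c : Fin p} {j : Fin l} {S : Relation (q.arity j) n} (hS : S ∈ F j) :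
    A.known F c j S ⊆ S :=
  fun _ ha => mem_revealed.1 ha S hS rfl

/-- A sound machine outputs only combinations of tuples that it knows. -/
lemma IsSoundOn.mem_known (hA : A.IsSoundOn (Fintype.piFinset F)) {I : q.Database n}
    (hI : I ∈ Fintype.piFinset F) {c : Fin p} {a : Fin k → Fin n}
    (ha : a ∈ A.out c fun j => A.msg c j (I j)) (j : Fin l) :
    (fun s => a (q.atom j s)) ∈ A.known F c j (I j) := by
  refine mem_revealed.2 fun S hS hmsg => ?_
  -- The support is a product, so `S_j` may be exchanged for any `S` with the same message. Machine
  -- `c` sees no difference and still outputs `a`, so soundness puts the projection into `S`.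
  have hI' : Function.update I j S ∈ Fintype.piFinset F := by
    rw [Fintype.mem_piFinset] at hI ⊢
    intro i
    rcases eq_or_ne i j with rfl | hij
    · simpa using hS
    · simpa [hij] using hI i
  have hmsgs : (fun i => A.msg c i (Function.update I j S i)) = fun i => A.msg c i (I i) := by
    funext i
    rcases eq_or_ne i j with rfl | hij
    · simpa using hmsg
    · simp [hij]
  have ha' : a ∈ A.output (Function.update I j S) :=
    mem_biUnion.2 ⟨c, mem_univ c, by rwa [hmsgs]⟩
  simpa using mem_eval.1 (hA _ hI' ha') j

/-- The probability that machine `c` knows the tuple `b` of `S_j`. -/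
noncomputable def knowProb (A : q.OneRoundAlgorithm n p)
    (F : ∀ j, Finset (Relation (q.arity j) n)) (c : Fin p) (j : Fin l)
    (b : Fin (q.arity j) → Fin n) : ℝ :=
  𝔼 S ∈ F j, if b ∈ A.known F c j S then 1 else 0

lemma knowProb_nonneg (c : Fin p) (j : Fin l) (b : Fin (q.arity j) → Fin n) :
    0 ≤ A.knowProb F c j b :=
  expect_nonneg fun _ _ => by split_ifs <;> norm_num

lemma knowProb_le (c : Fin p) (j : Fin l) (b : Fin (q.arity j) → Fin n) :
    A.knowProb F c j b ≤ 𝔼 S ∈ F j, if b ∈ S then 1 else 0 := by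
  refine expect_le_expect fun S hS => ?_
  by_cases h : b ∈ A.known F c j S
  · simp [h, known_subset hS h]
  · rw [if_neg h]
    split_ifs <;> norm_num

lemma sum_knowProb (c : Fin p) (j : Fin l) :
    ∑ b, A.knowProb F c j b = 𝔼 S ∈ F j, (#(A.known F c j S) : ℝ) := by
  unfold knowProb
  rw [← expect_sum_comm]
  exact expect_congr rfl fun S _ => by simp

/-- If every answer is output by some machine, then some machine knows all its tuples. -/
lemma prod_expect_le_sum_prod_knowProb (hA : ∀ I ∈ Fintype.piFinset F, A.output I = q.eval I)
    (a : Fin k → Fin n) :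
    ∏ j, (𝔼 S ∈ F j, if (fun s => a (q.atom j s)) ∈ S then (1 : ℝ) else 0) ≤
      ∑ c, ∏ j, A.knowProb F c j fun s => a (q.atom j s) := by
  unfold knowProb
  simp_rw [← expect_piFinset_prod]
  rw [← expect_sum_comm]
  -- By independence both sides are expectations over `I`, and the inequality is a union bound
  -- between indicators.
  refine expect_le_expect fun I hI => ?_
  have hnonneg : ∀ c ∈ (univ : Finset (Fin p)), (0 : ℝ) ≤
      ∏ j, if (fun s => a (q.atom j s)) ∈ A.known F c j (I j) then (1 : ℝ) else 0 :=
    fun c _ => prod_nonneg fun j _ => by split_ifs <;> norm_num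
  by_cases ha : a ∈ q.eval I
  · have ha' := ha
    rw [← hA I hI] at ha'
    obtain ⟨c, -, hc⟩ := mem_biUnion.1 ha'
    have hs : A.IsSoundOn (Fintype.piFinset F) := fun I hI => (hA I hI).subset
    refine le_trans ?_ (single_le_sum hnonneg (mem_univ c))
    simp [hs.mem_known hI hc, mem_eval.1 ha]
  · obtain ⟨j, hj⟩ := not_forall.1 (mt mem_eval.2 ha)
    rw [prod_eq_zero (mem_univ j) (if_neg hj)]
    exact sum_nonneg hnonneg

/-- An exact algorithm must reveal many tuples to its machines. -/
theorem one_le_sum_prod_expect_card_known {u : Fin l → ℝ} (hu : q.IsFractionalEdgePacking u)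
    {m : ℕ} (hm : 0 < m) (hn : 0 < n) (hF : ∀ j, (F j).Nonempty)
    (hsymm : ∀ j, Relation.IsSymmetricFamily (F j)) (hcard : ∀ j, ∀ S ∈ F j, #S = m)
    (hA : ∀ I ∈ Fintype.piFinset F, A.output I = q.eval I) :
    1 ≤ ∑ c, ∏ j, ((𝔼 S ∈ F j, (#(A.known F c j S) : ℝ)) / m) ^ u j := by
  classical
  have : Nonempty (Fin n) := ⟨⟨0, hn⟩⟩
  have hm' : (0 : ℝ) < m := by exact_mod_cast hm
  have hn' : (0 : ℝ) < n := by exact_mod_cast hn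
  have hρ : ∀ j (b : Fin (q.arity j) → Fin n),
      (𝔼 S ∈ F j, if b ∈ S then (1 : ℝ) else 0) = m / n ^ q.arity j := by
    intro j b
    have h : (n : ℝ) ^ q.arity j * #{R ∈ F j | b ∈ R} = m * #(F j) := by
      exact_mod_cast (hsymm j).card_filter_mem (hcard j) b
    have hFj : (0 : ℝ) < #(F j) := by exact_mod_cast (hF j).card_pos
    rw [expect_eq_sum_div_card, sum_boole, div_eq_div_iff hFj.ne' (by positivity)]
    linarith
  have hρpos : ∀ j, (0 : ℝ) < m / (n : ℝ) ^ q.arity j := fun j => by positivity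
  -- Known tuples belong to the relation, so `v c j b` is the conditional probability that `c` knows
  -- `b` given that `b` is in `S_j`; in particular it is at most one.
  set v : Fin p → ∀ j, (Fin (q.arity j) → Fin n) → ℝ :=
    fun c j b => A.knowProb F c j b / (m / (n : ℝ) ^ q.arity j) with hv
  have hv0 : ∀ c j b, 0 ≤ v c j b := fun c j b => div_nonneg (knowProb_nonneg c j b) (hρpos j).le
  have hv1 : ∀ c j b, v c j b ≤ 1 := fun c j b =>
    (div_le_one (hρpos j)).2 ((knowProb_le c j b).trans (hρ j b).le)
  have hmean : ∀ c j, 𝔼 a : Fin k → Fin n, v c j (fun s => a (q.atom j s)) =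
      (𝔼 S ∈ F j, (#(A.known F c j S) : ℝ)) / m := by
    intro c j
    rw [expect_comp_embedding (q.atom j) (v c j), hv]
    simp only
    have hc : (Fintype.card (Fin (q.arity j) → Fin n) : ℝ) = n ^ q.arity j := by simp
    rw [← expect_div, Fintype.expect_eq_sum_div_card, sum_knowProb, hc, div_div,
      mul_div_cancel₀ _ (pow_ne_zero _ hn'.ne')]
  have hpoint : ∀ a : Fin k → Fin n, 1 ≤ ∑ c, ∏ j, v c j (fun s => a (q.atom j s)) ^ u j := by
    intro a
    have h := prod_expect_le_sum_prod_knowProb hA a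
    simp_rw [hρ] at h
    have hpos : 0 < ∏ j, (m : ℝ) / (n : ℝ) ^ q.arity j := prod_pos fun j _ => hρpos j
    calc (1 : ℝ) ≤ (∑ c, ∏ j, A.knowProb F c j fun s => a (q.atom j s)) /
          ∏ j, (m : ℝ) / (n : ℝ) ^ q.arity j := (one_le_div hpos).2 h
      _ = ∑ c, ∏ j, v c j (fun s => a (q.atom j s)) := by
          rw [sum_div]
          exact sum_congr rfl fun c _ => (prod_div_distrib ..).symm
      _ ≤ _ := by
          refine sum_le_sum fun c _ => prod_le_prod (fun j _ => hv0 c j _) fun j _ => ?_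
          conv_lhs => rw [← Real.rpow_one (v c j _)]
          exact Real.rpow_le_rpow_of_exponent_ge' (hv0 c j _) (hv1 c j _) (hu.1 j) (hu.le_one j)
  calc (1 : ℝ) = 𝔼 _a : Fin k → Fin n, (1 : ℝ) := (expect_const univ_nonempty _).symm
    _ ≤ 𝔼 a : Fin k → Fin n, ∑ c, ∏ j, v c j (fun s => a (q.atom j s)) ^ u j :=
        expect_le_expect fun a _ => hpoint a
    _ = ∑ c, 𝔼 a : Fin k → Fin n, ∏ j, v c j (fun s => a (q.atom j s)) ^ u j :=
        expect_sum_comm ..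
    _ ≤ _ := by
        refine sum_le_sum fun c _ => ?_
        simp_rw [← hmean]
        refine expect_prod_rpow_le_of_dependsOn k (fun j a => v c j fun s => a (q.atom j s))
          (fun j => Set.range (q.atom j)) u ?_ (fun j a => hv0 c j _) hu.1 ?_
        · intro j a b hab
          have : (fun s => a (q.atom j s)) = fun s => b (q.atom j s) :=
            funext fun s => hab _ ⟨s, rfl⟩
          simp only [this]
        · intro i
          convert hu.2 i

/-- The bits that machine `c` receives on a worst-case input. -/
lemma exists_bits_eq_sum_sup (hF : ∀ j, (F j).Nonempty) (c : Fin p) :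
    ∃ I ∈ Fintype.piFinset F, A.bits I c = ∑ j, (F j).sup fun S => (A.msg c j S).length := by
  -- In a product support the longest messages of all locations occur together in one database.
  choose I hI hmax using fun j => exists_mem_eq_sup (F j) (hF j) fun S => (A.msg c j S).length
  exact ⟨I, Fintype.mem_piFinset.2 hI, sum_congr rfl fun j _ => (hmax j).symm⟩

lemma sup_length_le_load_mul (hF : ∀ j, (F j).Nonempty) (w : Fin p → ℝ≥0) (hw : ∀ c, 0 < w c)
    (c : Fin p) (j : Fin l) :
    (((F j).sup fun S => (A.msg c j S).length : ℕ) : ℝ≥0) ≤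
      A.load (Fintype.piFinset F) (linearCost w) * w c := by
  obtain ⟨I, hI, hbits⟩ := exists_bits_eq_sum_sup (A := A) hF c
  have h1 : linearCost w c (A.bits I c) ≤ A.load (Fintype.piFinset F) (linearCost w) :=
    le_trans (le_sup (f := fun c => linearCost w c (A.bits I c)) (mem_univ c))
      (le_sup (f := fun I => univ.sup fun c => linearCost w c (A.bits I c)) hI)
  rw [linearCost, div_le_iff₀ (hw c)] at h1
  refine le_trans (Nat.cast_le.2 ?_) h1
  rw [hbits]
  exact single_le_sum (f := fun j => (F j).sup fun S => (A.msg c j S).length)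
    (fun _ _ => Nat.zero_le _) (mem_univ j)

/-- The load of an exact algorithm on a product of symmetric spread families. -/
theorem lowerLoad_le_load {u : Fin l → ℝ} (hu : q.IsFractionalEdgePacking u)
    (hupos : 0 < ∑ j, u j) {m : ℕ} (hm : 0 < m) (hn : 0 < n) (hF : ∀ j, (F j).Nonempty)
    (hsymm : ∀ j, Relation.IsSymmetricFamily (F j)) (hcard : ∀ j, ∀ S ∈ F j, #S = m)
    {β : ℝ} (hβ₀ : 0 < β) (hβ₁ : β < 1) (hβ : ∀ j, IsSpreadFamily (F j) β)
    (w : Fin p → ℝ≥0) (hw : ∀ c, 0 < w c)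
    (hA : ∀ I ∈ Fintype.piFinset F, A.output I = q.eval I) :
    (lowerLoad m w (∑ j, u j) : ℝ) ≤
      Real.log 4 / Real.log β⁻¹ * A.load (Fintype.piFinset F) (linearCost w) := by
  set t := ∑ j, u j with ht
  set K := Real.log 4 / Real.log β⁻¹
  set L := A.load (Fintype.piFinset F) (linearCost w)
  have hK : 0 ≤ K :=
    div_nonneg (Real.log_nonneg (by norm_num)) (Real.log_nonneg ((one_le_inv₀ hβ₀).2 hβ₁.le))
  have hm' : (0 : ℝ) < m := by exact_mod_cast hm
  have hknown : ∀ c j, 𝔼 S ∈ F j, (#(A.known F c j S) : ℝ) ≤ K * (L * w c) := by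
    intro c j
    refine ((hβ j).expect_card_revealed_le (hF j) hβ₀ hβ₁ (A.msg c j) _ fun S hS =>
      le_sup (f := fun S => (A.msg c j S).length) hS).trans ?_
    exact mul_le_mul_of_nonneg_left (by exact_mod_cast sup_length_le_load_mul hF w hw c j) hK
  have hone : 1 ≤ (K * L / m) ^ t * ∑ c, (w c : ℝ) ^ t := by
    refine (one_le_sum_prod_expect_card_known hu hm hn hF hsymm hcard hA).trans ?_
    rw [mul_sum]
    refine sum_le_sum fun c _ => ?_
    -- Since `t = ∑ j, u j`, the power `(K * L / m * w c) ^ t` splits into one factor with exponent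
    -- `u j` per atom.
    rw [← Real.mul_rpow (by positivity) (by positivity), ht,
      Real.rpow_sum_of_nonneg (by positivity) fun j _ => hu.1 j]
    refine prod_le_prod (fun j _ => Real.rpow_nonneg
      (div_nonneg (expect_nonneg fun _ _ => Nat.cast_nonneg _) hm'.le) _) fun j _ => ?_
    refine Real.rpow_le_rpow
      (div_nonneg (expect_nonneg fun _ _ => Nat.cast_nonneg _) hm'.le) ?_ (hu.1 j)
    rw [div_mul_eq_mul_div]
    exact div_le_div_of_nonneg_right ((hknown c j).trans (mul_assoc ..).ge) hm'.le
  have hsum : 0 ≤ ∑ c, (w c : ℝ) ^ t := sum_nonneg fun c _ => by positivity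
  have hroot : 1 ≤ K * L / m * (∑ c, (w c : ℝ) ^ t) ^ (1 / t) := by
    have h := Real.one_le_rpow hone (one_div_pos.2 hupos).le
    rwa [Real.mul_rpow (by positivity) hsum, ← Real.rpow_mul (by positivity),
      mul_one_div_cancel hupos.ne', Real.rpow_one] at h
  have hlower : (lowerLoad m w t : ℝ) = m / (∑ c, (w c : ℝ) ^ t) ^ (1 / t) := by
    simp [lowerLoad]
  rw [hlower]
  refine div_le_of_le_mul₀ (by positivity) (by positivity) ?_
  rwa [div_mul_eq_mul_div, one_le_div hm'] at hroot

end OneRoundAlgorithm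

end ConjunctiveQuery

/-! ### Randomized algorithms -/

namespace ConjunctiveQuery

variable {k l : ℕ} {q : ConjunctiveQuery k l} {n p : ℕ}

/-- A sound randomized algorithm that is complete on average is exact for almost all coins. -/
theorem ae_output_eq_eval {D : Finset (q.Database n)} (hD : ∃ I ∈ D, (q.eval I).Nonempty)
    {Ω : Type*} [MeasurableSpace Ω] (P : Measure Ω) [IsProbabilityMeasure P]
    (A : Ω → q.OneRoundAlgorithm n p) (hs : ∀ᵐ ω ∂P, (A ω).IsSoundOn D)
    (hc : 𝔼 I ∈ D, ((q.eval I).card : ℝ) ≤ ∫ ω, 𝔼 I ∈ D, (((A ω).output I).card : ℝ) ∂P) :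
    ∀ᵐ ω ∂P, ∀ I ∈ D, (A ω).output I = q.eval I := by
  obtain ⟨I₀, hI₀, hne⟩ := hD
  have hDc : (0 : ℝ) < #D := by exact_mod_cast card_pos.2 ⟨I₀, hI₀⟩
  have hpos : 0 < 𝔼 I ∈ D, ((q.eval I).card : ℝ) := by
    rw [expect_eq_sum_div_card]
    refine div_pos (sum_pos' (fun _ _ => Nat.cast_nonneg _) ⟨I₀, hI₀, ?_⟩) hDc
    exact_mod_cast hne.card_pos
  -- Integrability is not assumed: a non-integrable function has integral `0` by convention, which
  -- contradicts `hc` because the left side there is positive.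
  have hint : Integrable (fun ω => 𝔼 I ∈ D, (((A ω).output I).card : ℝ)) P :=
    not_not.1 fun h => (hpos.trans_le hc).ne' (integral_undef h)
  have hle : ∀ᵐ ω ∂P, 0 ≤ 𝔼 I ∈ D, ((q.eval I).card : ℝ) -
      𝔼 I ∈ D, (((A ω).output I).card : ℝ) := by
    filter_upwards [hs] with ω hω
    exact sub_nonneg.2 (expect_le_expect fun I hI => Nat.cast_le.2 (card_le_card (hω I hI)))
  have hzero : ∫ ω, (𝔼 I ∈ D, ((q.eval I).card : ℝ) -
      𝔼 I ∈ D, (((A ω).output I).card : ℝ)) ∂P = 0 := by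
    refine le_antisymm ?_ (integral_nonneg_of_ae hle)
    rw [integral_sub (integrable_const _) hint]
    simpa using hc
  have hae := (integral_eq_zero_iff_of_nonneg_ae hle ((integrable_const _).sub hint)).1 hzero
  filter_upwards [hs, hae] with ω hω heq I hI
  refine eq_of_subset_of_card_le (hω I hI) ?_
  have hsum : ∑ I ∈ D, (((A ω).output I).card : ℝ) = ∑ I ∈ D, ((q.eval I).card : ℝ) := by
    have h : 𝔼 I ∈ D, ((q.eval I).card : ℝ) = 𝔼 I ∈ D, (((A ω).output I).card : ℝ) :=
      sub_eq_zero.1 heq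
    rw [expect_eq_sum_div_card, expect_eq_sum_div_card, div_left_inj' hDc.ne'] at h
    exact h.symm
  have := (sum_eq_sum_iff_of_le fun I hI =>
    Nat.cast_le (α := ℝ).2 (card_le_card (hω I hI))).1 hsum I hI
  exact (Nat.cast_injective this).ge

/-- The lower bound for the load on a product of symmetric spread families. -/
theorem ae_mul_lowerLoad_le_load {F : ∀ j, Finset (Relation (q.arity j) n)} {u : Fin l → ℝ}
    (hu : q.IsFractionalEdgePacking u) (hupos : 0 < ∑ j, u j) {m : ℕ} (hm : 0 < m) (hn : 0 < n)
    (hF : ∀ j, (F j).Nonempty) (hsymm : ∀ j, Relation.IsSymmetricFamily (F j))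
    (hcard : ∀ j, ∀ S ∈ F j, #S = m) {β : ℝ} (hβ₀ : 0 < β) (hβ₁ : β < 1)
    (hβ : ∀ j, IsSpreadFamily (F j) β) (w : Fin p → ℝ≥0) (hw : ∀ c, 0 < w c)
    {Ω : Type*} [MeasurableSpace Ω] (P : Measure Ω) [IsProbabilityMeasure P]
    (A : Ω → q.OneRoundAlgorithm n p) (hs : ∀ᵐ ω ∂P, (A ω).IsSoundOn (Fintype.piFinset F))
    (hc : 𝔼 I ∈ Fintype.piFinset F, ((q.eval I).card : ℝ) ≤
      ∫ ω, 𝔼 I ∈ Fintype.piFinset F, (((A ω).output I).card : ℝ) ∂P) :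
    ∀ᵐ ω ∂P, (Real.log β⁻¹ / Real.log 4).toNNReal * lowerLoad m w (∑ j, u j) ≤
      (A ω).load (Fintype.piFinset F) (linearCost w) := by
  have hlog : 0 < Real.log β⁻¹ := Real.log_pos ((one_lt_inv₀ hβ₀).2 hβ₁)
  have hlog4 : 0 < Real.log 4 := Real.log_pos (by norm_num)
  -- All tuples are equally likely and `m > 0`, so a constant tuple occurs in some member of each
  -- family; these members join to a nonempty answer.
  have hD : ∃ I ∈ Fintype.piFinset F, (q.eval I).Nonempty := by
    have hex : ∀ j, ∃ S ∈ F j, (fun _ => ⟨0, hn⟩) ∈ S := by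
      intro j
      have h := (hsymm j).card_filter_mem (hcard j) fun _ => ⟨0, hn⟩
      have hne : #{R ∈ F j | (fun _ => ⟨0, hn⟩) ∈ R} ≠ 0 := by
        intro h0
        rw [h0, mul_zero] at h
        exact (Nat.mul_pos hm (hF j).card_pos).ne h
      obtain ⟨S, hS⟩ := card_ne_zero.1 hne
      exact ⟨S, (mem_filter.1 hS).1, (mem_filter.1 hS).2⟩
    choose I hI hmem using hex
    exact ⟨I, Fintype.mem_piFinset.2 hI, fun _ => ⟨0, hn⟩, mem_eval.2 hmem⟩
  filter_upwards [ae_output_eq_eval hD P A hs hc] with ω hω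
  have h := OneRoundAlgorithm.lowerLoad_le_load hu hupos hm hn hF hsymm hcard hβ₀ hβ₁ hβ w hw hω
  rw [← NNReal.coe_le_coe, NNReal.coe_mul, Real.coe_toNNReal _ (by positivity)]
  calc _ ≤ Real.log β⁻¹ / Real.log 4 * (Real.log 4 / Real.log β⁻¹ *
        (A ω).load (Fintype.piFinset F) (linearCost w)) := by gcongr
    _ = _ := by rw [← mul_assoc, div_mul_div_cancel₀ hlog4.ne', div_self hlog.ne', one_mul]

lemma matchingDatabases_eq (q : ConjunctiveQuery k l) (n m : ℕ) :
    q.matchingDatabases n m = Fintype.piFinset fun j => Relation.matchings (q.arity j) n m := by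
  ext I
  simp [matchingDatabases, Relation.mem_matchings]

lemma denseDatabases_eq (q : ConjunctiveQuery k l) {θ : ℝ} {n m : ℕ}
    (hm : ∀ j, m = ⌊θ * (n : ℝ) ^ q.arity j⌋₊) :
    q.denseDatabases θ n = Fintype.piFinset fun _ => powersetCard m univ := by
  ext I
  simp [denseDatabases, ← hm]

end ConjunctiveQuery

lemma lowerLoad_zero {p : ℕ} (w : Fin p → ℝ≥0) (t : ℝ) : lowerLoad 0 w t = 0 := by
  simp [lowerLoad]

/-- The randomness of the algorithm is a probability space `(Ω, P)` of coins shared by everybody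
(a deterministic algorithm is the case of a one-point `Ω`). -/
theorem mainTheorem1 (θ : ℝ) (hθ₀ : 0 < θ) (hθ₁ : θ < 1) :
    ∃ C : ℝ≥0, 0 < C ∧
      ∀ (k l : ℕ) (q : ConjunctiveQuery k l) (u : Fin l → ℝ),
        q.IsFractionalEdgePacking u → 0 < ∑ j, u j →
      ∀ (n m p : ℕ) (w : Fin p → ℝ≥0), (∀ c, 0 < w c) →
      ∀ (Ω : Type*) [MeasurableSpace Ω] (P : Measure Ω) [IsProbabilityMeasure P]
        (A : Ω → q.OneRoundAlgorithm n p),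
        -- matching databases
        (2 ≤ n → m ≤ n → (∀ j, q.arity j = 1 → (m : ℝ) ≤ θ * n) →
          (∀ᵐ ω ∂P, (A ω).IsSoundOn (q.matchingDatabases n m)) →
          𝔼 I ∈ q.matchingDatabases n m, ((q.eval I).card : ℝ) ≤
            ∫ ω, 𝔼 I ∈ q.matchingDatabases n m, (((A ω).output I).card : ℝ) ∂P →
          ∀ᵐ ω ∂P, C * lowerLoad m w (∑ j, u j) ≤
            (A ω).load (q.matchingDatabases n m) (linearCost w)) ∧
        -- dense databases
        ((∀ j, m = ⌊θ * (n : ℝ) ^ q.arity j⌋₊) →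
          (∀ᵐ ω ∂P, (A ω).IsSoundOn (q.denseDatabases θ n)) →
          𝔼 I ∈ q.denseDatabases θ n, ((q.eval I).card : ℝ) ≤
            ∫ ω, 𝔼 I ∈ q.denseDatabases θ n, (((A ω).output I).card : ℝ) ∂P →
          ∀ᵐ ω ∂P, C * lowerLoad m w (∑ j, u j) ≤
            (A ω).load (q.denseDatabases θ n) (linearCost w)) := by
  -- One spread parameter for all cases: `θ` for `m`-subsets (dense or unary relations), `3 / 4` for
  -- matchings of arity at least two.
  have hβ₀ : 0 < max θ (3 / 4) := lt_max_of_lt_left hθ₀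
  have hβ₁ : max θ (3 / 4) < 1 := max_lt hθ₁ (by norm_num)
  refine ⟨(Real.log (max θ (3 / 4))⁻¹ / Real.log 4).toNNReal, Real.toNNReal_pos.2
    (div_pos (Real.log_pos ((one_lt_inv₀ hβ₀).2 hβ₁)) (Real.log_pos (by norm_num))), ?_⟩
  intro k l q u hu hupos n m p w hw Ω _ P _ A
  rcases m.eq_zero_or_pos with rfl | hm
  · simp [lowerLoad_zero]
  refine ⟨fun hn hmn hone hs hc => ?_, fun hdense hs hc => ?_⟩
  · rw [q.matchingDatabases_eq] at hs hc ⊢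
    refine ConjunctiveQuery.ae_mul_lowerLoad_le_load hu hupos hm (by omega)
      (fun j => Relation.matchings_nonempty (q.arity_pos j) hmn)
      (fun j => Relation.isSymmetricFamily_matchings m)
      (fun j S hS => (Relation.mem_matchings.1 hS).2) hβ₀ hβ₁ (fun j => ?_) w hw P A hs hc
    rcases (Nat.succ_le_of_lt (q.arity_pos j)).eq_or_lt with hj | hj
    · have hspread : ∀ r, r = 1 → IsSpreadFamily (Relation.matchings r n m) θ := by
        rintro r rfl
        rw [Relation.matchings_one]
        exact isSpreadFamily_powersetCard hθ₀.le hθ₁.le (by simpa using hone j hj.symm)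
      exact (hspread _ hj.symm).mono hθ₀.le (le_max_left _ _)
    · exact (Relation.isSpreadFamily_matchings hj hn).mono (by norm_num) (le_max_right _ _)
  · rw [q.denseDatabases_eq hdense] at hs hc ⊢
    have hle : ∀ j, (m : ℝ) ≤ θ * Fintype.card (Fin (q.arity j) → Fin n) := by
      intro j
      simpa using (Nat.cast_le.2 (hdense j).le).trans
        (Nat.floor_le (by positivity : 0 ≤ θ * (n : ℝ) ^ q.arity j))
    -- Positive total weight forces an atom to exist. Its arity is positive, so `n = 0` would give
    -- `m = 0`.
    have hn : 0 < n := by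
      obtain ⟨j⟩ : Nonempty (Fin l) := by
        by_contra h
        rw [not_nonempty_iff] at h
        simp at hupos
      rcases n.eq_zero_or_pos with rfl | hn
      · have := hdense j
        rw [Nat.cast_zero, zero_pow (q.arity_pos j).ne', mul_zero, Nat.floor_zero] at this
        omega
      · exact hn
    refine ConjunctiveQuery.ae_mul_lowerLoad_le_load hu hupos hm hn
      (fun j => powersetCard_nonempty.2 ?_)
      (fun j => Relation.isSymmetricFamily_powersetCard m)
      (fun j S hS => (mem_powersetCard.1 hS).2) hβ₀ hβ₁
      (fun j => (isSpreadFamily_powersetCard hθ₀.le hθ₁.le (hle j)).mono hθ₀.le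
        (le_max_left _ _)) w hw P A hs hc
    have : (m : ℝ) ≤ Fintype.card (Fin (q.arity j) → Fin n) :=
      (hle j).trans (mul_le_of_le_one_left (Nat.cast_nonneg _) hθ₁.le)
    rw [card_univ]
    exact_mod_cast this
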